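/- Fix an even integer $n\ge 4$. Put $v_i=e^{\mathbf i\, i\pi/n}$ for $0\le i<n$, and consider edge-to-edge tilings of the plane by translates of the unit rhombuses $t_{i,j}$ spanned by $v_i,v_j$ ($0\le i<j<n$). An edgeword is a finite word $u$ over $A_n=\{0,2,4,\dots,n-2\}$. Laid out in a direction $v$, the letter $0$ stands for a unit edge in direction $v$, and the letter $2k>0$ for a unit rhombus of angle $2k\pi/n$ crossed along the diagonal, in direction $v$, that bisects this angle. A substitution $\sigma$ defined by $u$ assigns to each prototile $t$ a finite patch $\sigma(t)$ and comes with an orientation-preserving similitude $\phi$ (multiplication by a complex number) such that: for each edge $[q,q+v_i]$ of $t$, the word $u$ laid out from $\phi(q)$ in direction $v_i$ ends at $\phi(q+v_i)$ and consists of external edges and external tiles of $\sigma(t)$ (the boundary tiles are the tiles so obtained from the four edges); the area of $\phi(t)$ is the area of $\sigma(t)$ with boundary tiles counted for half; and $\sigma$ is well-defined, that is, putting $\sigma(x+t)=\phi(x)+\sigma(t)$ and gluing the images of distinct tiles along boundary tiles and edges only, all metatiles $\sigma^k(t)$, $k\ge 0$, are patches (finite, edge-to-edge, simply connected). A tiling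 is legal for $\sigma$ if each of its finite sets of tiles appears, up to translation, in some metatile $\sigma^k(t)$. A tiling is lifted to a surface made of unit squares in $\mathbb R^n$ by sending a vertex to the origin and each edge direction $v_i$ to the canonical basis vector $e_i$. It is a discrete plane of slope $\mathcal E$ if the lifted surface stays within bounded distance of the plane $\mathcal E$. The substitution $\sigma$ is planar of slope $\mathcal E$ if every tiling legal for $\sigma$ is a discrete plane of slope $\mathcal E$. Let $\mathcal E_n^0=\left\langle (\cos\tfrac{i\pi}{n})_{0\le i<n},(\sin\tfrac{i\pi}{n})_{0\le i<n}\right\rangle\subset\mathbb R^n$ and $\gamma=(\cos\tfrac{i\pi}{n})_{0\le i<n/2}\in\mathbb R^{n/2}$, and let $[u]=(|u|_{2i})_{0\le i<n/2}$ be the vector of the numbers of occurrences of the letters in $u$. **Lemma.** There exist $\epsilon>0$ and $l\in\mathbb N$ (depending only on $n$) such that, for every edgeword $u$ of length at least $l$ and every substitution $\sigma$ defined by $u$, $$d([u],\langle\gamma\rangle)<\epsilon\ \Longrightarrow\ \phi \text{ is expanding (its ratio is greater than 1) and } \sigma \text{ is planar of slope } \mathcal E_n^0,$$ where $d$ is the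 Euclidean distance. -/

import Mathlib

open scoped ENNReal

namespace PlanarRosa

noncomputable section

/-! ## Rhombus tiles with `n` edge directions -/

/-- The unit vector `exp(𝐢 π d / n)`. Oriented edge directions are indexed by `d : ZMod (2 * n)`:
the directions `0, …, n - 1` are those of `v_0, …, v_{n-1}`, and `d + n` is opposite to `d`. -/
def vec (n : ℕ) (d : ZMod (2 * n)) : ℂ :=
  Complex.exp (((Real.pi * (d.val : ℝ) / (n : ℝ) : ℝ) : ℂ) * Complex.I)

/-- The direction of `v_i` as an oriented edge direction. -/
def dir {n : ℕ} (i : Fin n) : ZMod (2 * n) := ((i : ℕ) : ZMod (2 * n))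

/-- A prototile: a pair of indices `i < j`, standing for the unit rhombus spanned by
`v_i` and `v_j`. -/
structure Prototile (n : ℕ) where
  i : Fin n
  j : Fin n
  lt : i < j

/-- A tile: a prototile placed at a position of the Euclidean plane. -/
structure Tile (n : ℕ) where
  pos : ℂ
  proto : Prototile n

/-- The closed rhombus covered by a tile. -/
def Tile.carrier {n : ℕ} (τ : Tile n) : Set ℂ :=
  {z | ∃ a ∈ Set.Icc (0 : ℝ) 1, ∃ b ∈ Set.Icc (0 : ℝ) 1,
    z = τ.pos + (a : ℂ) * vec n (dir τ.proto.i) + (b : ℂ) * vec n (dir τ.proto.j)}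

/-- The tile translated by `c`. -/
def Tile.translate {n : ℕ} (c : ℂ) (τ : Tile n) : Tile n := ⟨c + τ.pos, τ.proto⟩

/-- `q` is a vertex of the tile, and the two edges of the tile that leave `q` have the oriented
directions `a` and `b` (in either order). -/
def Tile.IsCorner {n : ℕ} (τ : Tile n) (q : ℂ) (a b : ZMod (2 * n)) : Prop :=
  ∃ s t : ℕ, s ≤ 1 ∧ t ≤ 1 ∧
    q = τ.pos + (s : ℂ) * vec n (dir τ.proto.i) + (t : ℂ) * vec n (dir τ.proto.j) ∧
    ((a = dir τ.proto.i + ((s * n : ℕ) : ZMod (2 * n)) ∧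
        b = dir τ.proto.j + ((t * n : ℕ) : ZMod (2 * n))) ∨
      (a = dir τ.proto.j + ((t * n : ℕ) : ZMod (2 * n)) ∧
        b = dir τ.proto.i + ((s * n : ℕ) : ZMod (2 * n))))

/-- The segment from `q` to `q + vec n a` is an edge of the tile. -/
def Tile.HasEdge {n : ℕ} (τ : Tile n) (q : ℂ) (a : ZMod (2 * n)) : Prop :=
  ∃ b, τ.IsCorner q a b

/-- `q` is a vertex of the tile. -/
def Tile.HasVertex {n : ℕ} (τ : Tile n) (q : ℂ) : Prop := ∃ a, τ.HasEdge q a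

/-- The segment from `q` to `q + vec n a` is an edge of some tile of `S`. -/
def HasEdge {n : ℕ} (S : Set (Tile n)) (q : ℂ) (a : ZMod (2 * n)) : Prop :=
  ∃ τ ∈ S, τ.HasEdge q a

/-- `q` is a vertex of some tile of `S`. -/
def HasVertex {n : ℕ} (S : Set (Tile n)) (q : ℂ) : Prop := ∃ τ ∈ S, τ.HasVertex q

/-- Two distinct tiles that intersect meet exactly in a common vertex or in a common full edge.
In particular the interiors of distinct tiles are disjoint. -/
def IsEdgeToEdge {n : ℕ} (S : Set (Tile n)) : Prop :=
  ∀ τ ∈ S, ∀ τ' ∈ S, τ ≠ τ' →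
    τ.carrier ∩ τ'.carrier = ∅ ∨
    (∃ q, τ.HasVertex q ∧ τ'.HasVertex q ∧ τ.carrier ∩ τ'.carrier = {q}) ∨
    (∃ q a, τ.HasEdge q a ∧ τ'.HasEdge q a ∧
      τ.carrier ∩ τ'.carrier = segment ℝ q (q + vec n a))

/-- An edge-to-edge tiling of the Euclidean plane by unit rhombuses with `n` edge directions. -/
structure IsTiling {n : ℕ} (T : Set (Tile n)) : Prop where
  edgeToEdge : IsEdgeToEdge T
  covers : ⋃ τ ∈ T, τ.carrier = Set.univ

/-! ## Edge paths, connectedness and simple connectedness -/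

/-- The displacement of the edge path with the given successive oriented directions. -/
def displacement {n : ℕ} (l : List (ZMod (2 * n))) : ℂ := (l.map (vec n)).sum

/-- The path that starts at `q` and has the given successive oriented directions runs along
edges of tiles of `S`. -/
def IsEdgePath {n : ℕ} (S : Set (Tile n)) : ℂ → List (ZMod (2 * n)) → Prop
  | _, [] => True
  | q, a :: l => HasEdge S q a ∧ IsEdgePath S (q + vec n a) l

/-- Any two vertices of `S` are joined by an edge path of `S`. -/
def IsConnectedSet {n : ℕ} (S : Set (Tile n)) : Prop :=
  ∀ p q, HasVertex S p → HasVertex S q →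
    ∃ l : List (ZMod (2 * n)), IsEdgePath S p l ∧ p + displacement l = q

/-- The elementary homotopies of edge paths starting at `q` in the cell complex of `S`: deleting
an edge that is run through forth and back, and pushing two consecutive edges of a
tile of `S` across that tile. -/
inductive ElementaryHomotopy {n : ℕ} (S : Set (Tile n)) (q : ℂ) :
    List (ZMod (2 * n)) → List (ZMod (2 * n)) → Prop
  | cancel (l l' : List (ZMod (2 * n))) (a : ZMod (2 * n))
      (h : HasEdge S (q + displacement l) a) :
      ElementaryHomotopy S q (l ++ a :: (a + (n : ZMod (2 * n))) :: l') (l ++ l')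
  | flip (l l' : List (ZMod (2 * n))) (a b : ZMod (2 * n)) (τ : Tile n) (hτ : τ ∈ S)
      (h : τ.IsCorner (q + displacement l) a b) :
      ElementaryHomotopy S q (l ++ a :: b :: l') (l ++ b :: a :: l')

/-- The cell complex formed by the tiles of `S` is connected and every closed edge path
in it is null-homotopic. -/
def IsSimplyConnectedSet {n : ℕ} (S : Set (Tile n)) : Prop :=
  IsConnectedSet S ∧
    ∀ q, HasVertex S q → ∀ l : List (ZMod (2 * n)), IsEdgePath S q l → displacement l = 0 →
      Relation.EqvGen (ElementaryHomotopy S q) l []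

/-- A finite patch of tiles. -/
structure IsPatch {n : ℕ} (S : Set (Tile n)) : Prop where
  finite : S.Finite
  edgeToEdge : IsEdgeToEdge S
  simplyConnected : IsSimplyConnectedSet S

/-- An edge of the patch `S` is external when it belongs to exactly one tile of `S`. -/
def IsExternalEdge {n : ℕ} (S : Set (Tile n)) (q : ℂ) (a : ZMod (2 * n)) : Prop :=
  ∃! τ, τ ∈ S ∧ τ.HasEdge q a

/-- A tile of the patch `S` is external when one of its edges is an external edge of `S`. -/
def IsExternalTile {n : ℕ} (S : Set (Tile n)) (τ : Tile n) : Prop :=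
  τ ∈ S ∧ ∃ q a, τ.HasEdge q a ∧ IsExternalEdge S q a

/-! ## Substitutions defined by an edgeword -/

/-- The alphabet `{0, 2, 4, …, n - 2}` (for even `n`). -/
def alphabet (n : ℕ) : Set ℕ := {a | Even a ∧ a < n}

/-- The displacement along one letter in direction `d`: the letter `0` is a unit edge of direction
`d`, and the letter `2k > 0` is a rhombus of angle `2kπ/n` crossed along the diagonal of
direction `d` that bisects this angle. -/
def letterVec {n : ℕ} (d : ZMod (2 * n)) (a : ℕ) : ℂ :=
  if a = 0 then vec n d
  else vec n (d + ((a / 2 : ℕ) : ZMod (2 * n))) + vec n (d - ((a / 2 : ℕ) : ZMod (2 * n)))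

/-- The displacement along a whole word in direction `d`. -/
def wordVec {n : ℕ} (d : ZMod (2 * n)) (u : List ℕ) : ℂ := (u.map (letterVec d)).sum

/-- The word `u`, laid out from the point `p` in direction `d`, has at `q` the letter `a`. -/
def LetterAt {n : ℕ} (u : List ℕ) (p : ℂ) (d : ZMod (2 * n)) (q : ℂ) (a : ℕ) : Prop :=
  ∃ w w' : List ℕ, u = w ++ a :: w' ∧ q = p + wordVec d w

/-- `τ` is the rhombus that the nonzero letter `a` encodes, started at `q` in direction `d`. -/
def IsLetterTile {n : ℕ} (d : ZMod (2 * n)) (q : ℂ) (a : ℕ) (τ : Tile n) : Prop :=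
  τ.IsCorner q (d + ((a / 2 : ℕ) : ZMod (2 * n))) (d - ((a / 2 : ℕ) : ZMod (2 * n)))

/-- A substitution: a set of tiles for each prototile, and the expansion `z ↦ factor * z`,
an orientation preserving similitude of the plane. -/
structure Substitution (n : ℕ) where
  image : Prototile n → Set (Tile n)
  factor : ℂ

namespace Substitution

variable {n : ℕ}

/-- The image of a tile: the image of its prototile, placed at the expanded position. -/
def imageTile (σ : Substitution n) (τ : Tile n) : Set (Tile n) :=
  Tile.translate (σ.factor * τ.pos) '' σ.image τ.proto

/-- The image of a set of tiles: the images of the tiles, glued together. -/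
def apply (σ : Substitution n) (S : Set (Tile n)) : Set (Tile n) := ⋃ τ ∈ S, σ.imageTile τ

/-- The metatile of order `k` of type `t`. -/
def metatile (σ : Substitution n) (k : ℕ) (t : Prototile n) : Set (Tile n) :=
  σ.apply^[k] {⟨0, t⟩}

/-- The rhombuses of the word `u` along the four edges of the expanded prototile `t`. An edge from
`q` to `q + v_d` of `t`, `d ∈ {t.i, t.j}`, gives rise to the word `u` laid out from `factor * q`
in the direction of `v_d`. -/
def boundaryTiles (σ : Substitution n) (u : List ℕ) (t : Prototile n) : Set (Tile n) :=
  {τ | ∃ (q : ℂ) (d : Fin n) (q' : ℂ) (a : ℕ), (⟨0, t⟩ : Tile n).HasEdge q (dir d) ∧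
    LetterAt u (σ.factor * q) (dir d) q' a ∧ a ≠ 0 ∧ IsLetterTile (dir d) q' a τ}

/-- `σ` is a well-defined vertex-hierarchic substitution such that the image of every edge of every
prototile is, up to rotation and translation, the sequence of edges and rhombuses encoded
by the word `u`. -/
structure IsDefinedBy (σ : Substitution n) (u : List ℕ) : Prop where
  /-- The image of an edge starts and ends at the vertices of the expanded edge. -/
  vertices : ∀ (t : Prototile n) (q : ℂ) (d : Fin n), (⟨0, t⟩ : Tile n).HasEdge q (dir d) →
    σ.factor * q + wordVec (dir d) u = σ.factor * (q + vec n (dir d))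
  /-- Each letter `0` of the image of an edge is an external edge of the image of the tile. -/
  edges : ∀ (t : Prototile n) (q : ℂ) (d : Fin n) (q' : ℂ),
    (⟨0, t⟩ : Tile n).HasEdge q (dir d) → LetterAt u (σ.factor * q) (dir d) q' 0 →
      IsExternalEdge (σ.image t) q' (dir d)
  /-- Each nonzero letter of the image of an edge is an external tile of the image of the tile. -/
  rhombuses : ∀ (t : Prototile n) (q : ℂ) (d : Fin n) (q' : ℂ) (a : ℕ),
    (⟨0, t⟩ : Tile n).HasEdge q (dir d) → LetterAt u (σ.factor * q) (dir d) q' a → a ≠ 0 →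
      ∃ τ, IsExternalTile (σ.image t) τ ∧ IsLetterTile (dir d) q' a τ
  /-- The expanded tile has the same area as its image, boundary tiles being counted for half. -/
  area : ∀ t : Prototile n,
    MeasureTheory.volume ((fun z : ℂ => σ.factor * z) '' (⟨0, t⟩ : Tile n).carrier) =
      MeasureTheory.volume (⋃ τ ∈ σ.image t \ σ.boundaryTiles u t, τ.carrier) +
        (1 / 2 : ℝ≥0∞) * MeasureTheory.volume (⋃ τ ∈ σ.boundaryTiles u t, τ.carrier)
  /-- The substitution extends to its whole sequence of metatiles: each metatile is a patch. -/
  patch : ∀ (k : ℕ) (t : Prototile n), IsPatch (σ.metatile k t)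
  /-- The images of distinct tiles of a metatile are glued along boundary tiles only. -/
  gluing : ∀ (k : ℕ) (t : Prototile n), ∀ τ ∈ σ.metatile k t, ∀ τ' ∈ σ.metatile k t, τ ≠ τ' →
    σ.imageTile τ ∩ σ.imageTile τ' ⊆
      Tile.translate (σ.factor * τ.pos) '' σ.boundaryTiles u τ.proto ∩
        Tile.translate (σ.factor * τ'.pos) '' σ.boundaryTiles u τ'.proto

/-- A tiling is legal for `σ` when every finite set of its tiles appears, up to translation, in
some metatile. -/
def IsLegal (σ : Substitution n) (T : Set (Tile n)) : Prop :=
  ∀ F : Set (Tile n), F ⊆ T → F.Finite →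
    ∃ (k : ℕ) (t : Prototile n) (c : ℂ), Tile.translate c '' F ⊆ σ.metatile k t

end Substitution

/-! ## Lifting to `ℝⁿ` and discrete planes -/

/-- The lift of an oriented edge direction: `v_m` is lifted to the basis vector `e_m`, and
`-v_m` to `-e_m`. -/
def step {n : ℕ} (a : ZMod (2 * n)) : Fin n → ℤ := fun m =>
  if a = dir m then 1 else if a = dir m + (n : ZMod (2 * n)) then -1 else 0

/-- `L` lifts the vertices of `T` to `ℤⁿ`, with the vertex `o` sent to the origin: along every
edge path from `o`, the lift is the abelianized path. -/
def IsLift {n : ℕ} (T : Set (Tile n)) (o : ℂ) (L : ℂ → Fin n → ℤ) : Prop :=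
  L o = 0 ∧ ∀ q a, HasEdge T q a → L (q + vec n a) = L q + step a

/-- The lifted discrete surface: the union of the unit squares `L(x) + [0,1] e_i + [0,1] e_j`,
for the tiles of type `i, j` at position `x` in `T`. -/
def liftedSurface {n : ℕ} (T : Set (Tile n)) (L : ℂ → Fin n → ℤ) :
    Set (EuclideanSpace ℝ (Fin n)) :=
  {x | ∃ τ ∈ T, ∃ a ∈ Set.Icc (0 : ℝ) 1, ∃ b ∈ Set.Icc (0 : ℝ) 1,
    x = WithLp.toLp 2 (fun m => (L τ.pos m : ℝ)) +
      a • EuclideanSpace.single τ.proto.i (1 : ℝ) + b • EuclideanSpace.single τ.proto.j (1 : ℝ)}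

/-- `T` is a discrete plane of slope `E`: lifted from any of its vertices, it stays within bounded
distance of `E`. -/
def IsDiscretePlane {n : ℕ} (T : Set (Tile n))
    (E : Submodule ℝ (EuclideanSpace ℝ (Fin n))) : Prop :=
  ∀ o, HasVertex T o → ∃ L : ℂ → Fin n → ℤ, IsLift T o L ∧
    ∃ C : ℝ, ∀ x ∈ liftedSurface T L, Metric.infDist x (E : Set (EuclideanSpace ℝ (Fin n))) ≤ C

/-- `σ` is planar of slope `E`: every tiling that is legal for `σ` is a discrete plane of
slope `E`. -/
def Substitution.IsPlanar {n : ℕ} (σ : Substitution n)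
    (E : Submodule ℝ (EuclideanSpace ℝ (Fin n))) : Prop :=
  ∀ T : Set (Tile n), IsTiling T → σ.IsLegal T → IsDiscretePlane T E

/-- The plane `E_n^k` of `ℝⁿ`. -/
def slope (n k : ℕ) : Submodule ℝ (EuclideanSpace ℝ (Fin n)) :=
  Submodule.span ℝ
    {WithLp.toLp 2 (fun i : Fin n => Real.cos ((2 * (k : ℝ) + 1) * ((i : ℕ) : ℝ) * Real.pi / n)),
      WithLp.toLp 2 (fun i : Fin n => Real.sin ((2 * (k : ℝ) + 1) * ((i : ℕ) : ℝ) * Real.pi / n))}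

/-- The vector `γ = (cos (iπ/n))_{0 ≤ i < n/2}`. -/
def gammaVec (n : ℕ) : EuclideanSpace ℝ (Fin (n / 2)) :=
  WithLp.toLp 2 (fun i : Fin (n / 2) => Real.cos (((i : ℕ) : ℝ) * Real.pi / n))

/-- The abelianized edgeword `[u]`: its `i`-th coordinate is the number of letters `2i`
in `u`. -/
def abelianized (n : ℕ) (u : List ℕ) : EuclideanSpace ℝ (Fin (n / 2)) :=
  WithLp.toLp 2 (fun i : Fin (n / 2) => ((u.count (2 * (i : ℕ)) : ℕ) : ℝ))

end

end PlanarRosa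

namespace PlanarRosa

noncomputable section

variable {n : ℕ}

/-! ## Directions as an additive character -/

/-! For odd `c`, let `charLift c` be the additive map from `ℤⁿ` to `ℂ` with `e_m ↦ exp(𝐢πcm/n)`; it
sends the lift of an edge of any oriented direction `a` to `exp(𝐢πca/n)`. Substituting an edge of
direction `d` replaces it by edges of directions `d`, or `d + k` and `d - k`, so each `charLift c`
is multiplied by `λ_c(u) = |u|_0 + 2 ∑_{i>0} |u|_{2i} cos(ciπ/n)`, which does not depend on `d`. The
abelianized substitution is thus diagonal in these characters.

The index `c = 1` is the projection to the tiled plane and `λ_1(u)` is the factor of `φ`; the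
indices `±1` correspond to `E_n^0`. For every other odd `c`, the linear form `[u] ↦ λ_c(u)` vanishes
on `γ` (`sum_cos_mul_letterEigenvalue`), so `[u]` close to `⟨γ⟩` forces `|λ_c(u)| < 1`
(`norm_wordEigenvalue_lt_one`). In contrast, every letter adds at least `2/n` to `λ_1(u)`, so long
words expand.

Contraction yields planarity. Simple connectedness makes the lift of a path in a metatile depend on
its endpoints only. Up to bounded pieces inside images of tiles, a path of `σ^(m+1)(t)` is the image
of a path of `σ^m(t)`, so a bound `D` on `|charLift c|` survives the recursion `D ↦ |λ_c| D + 2N`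
(`IsDefinedBy.exists_norm_charLift_le`). A path in a legal tiling is a translate of a path in a
metatile, and Fourier inversion turns the bounds for `c ≠ ±1` into a bound on the distance to
`E_n^0`. -/

theorem vec_eq_stdAddChar [NeZero n] (a : ZMod (2 * n)) : vec n a = ZMod.stdAddChar a := by
  have hn : (n : ℂ) ≠ 0 := by exact_mod_cast NeZero.ne n
  rw [ZMod.stdAddChar_apply, ZMod.toCircle_apply, vec]
  congr 1
  push_cast
  field_simp

theorem vec_add [NeZero n] (a b : ZMod (2 * n)) : vec n (a + b) = vec n a * vec n b := by
  simp only [vec_eq_stdAddChar, AddChar.map_add_eq_mul]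

theorem vec_zero [NeZero n] : vec n 0 = 1 := by
  simp only [vec_eq_stdAddChar, AddChar.map_zero_eq_one]

theorem vec_natCast_mul [NeZero n] (k : ℕ) (a : ZMod (2 * n)) :
    vec n ((k : ZMod (2 * n)) * a) = vec n a ^ k := by
  rw [← nsmul_eq_mul, vec_eq_stdAddChar, AddChar.map_nsmul_eq_pow, vec_eq_stdAddChar]

theorem vec_natCast [NeZero n] (k : ℕ) :
    vec n (k : ZMod (2 * n)) = Complex.exp (((k * Real.pi / n : ℝ) : ℂ) * Complex.I) := by
  have hn : (n : ℂ) ≠ 0 := by exact_mod_cast NeZero.ne n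
  have h := ZMod.stdAddChar_coe (N := 2 * n) (k : ℤ)
  rw [vec_eq_stdAddChar]
  push_cast at h ⊢
  rw [h]
  congr 1
  field_simp

theorem vec_half [NeZero n] : vec n (n : ZMod (2 * n)) = -1 := by
  have hn : (n : ℝ) ≠ 0 := by exact_mod_cast NeZero.ne n
  rw [vec_natCast, mul_div_assoc, mul_div_cancel₀ _ hn, Complex.exp_pi_mul_I]

theorem vec_add_half [NeZero n] (a : ZMod (2 * n)) :
    vec n (a + (n : ZMod (2 * n))) = -vec n a := by
  rw [vec_add, vec_half]; ring

theorem vec_ne_zero (a : ZMod (2 * n)) : vec n a ≠ 0 := Complex.exp_ne_zero _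

theorem norm_vec (a : ZMod (2 * n)) : ‖vec n a‖ = 1 := Complex.norm_exp_ofReal_mul_I _

theorem vec_natCast_re [NeZero n] (k : ℕ) :
    (vec n (k : ZMod (2 * n))).re = Real.cos (k * Real.pi / n) := by
  rw [vec_natCast, Complex.exp_ofReal_mul_I_re]

theorem vec_neg [NeZero n] (a : ZMod (2 * n)) : vec n (-a) = (starRingEnd ℂ) (vec n a) := by
  rw [vec_eq_stdAddChar, vec_eq_stdAddChar, AddChar.map_neg_eq_conj]

theorem vec_eq_one_iff [NeZero n] (a : ZMod (2 * n)) : vec n a = 1 ↔ a = 0 := by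
  rw [vec_eq_stdAddChar]
  constructor
  · intro h
    apply ZMod.injective_stdAddChar
    rw [h, AddChar.map_zero_eq_one]
  · rintro rfl
    exact AddChar.map_zero_eq_one _

theorem half_add_half : (n : ZMod (2 * n)) + n = 0 := by
  have := ZMod.natCast_self (2 * n)
  push_cast at this
  rw [← two_mul, this]

theorem odd_mul_half (k : ℕ) : ((2 * k + 1 : ℕ) : ZMod (2 * n)) * n = n := by
  have := half_add_half (n := n)
  push_cast
  linear_combination (k : ZMod (2 * n)) * this

theorem natCast_inj_of_lt {a b : ℕ} (ha : a < 2 * n) (hb : b < 2 * n)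
    (h : (a : ZMod (2 * n)) = b) : a = b := by
  rw [ZMod.natCast_eq_natCast_iff] at h
  exact Nat.ModEq.eq_of_lt_of_lt h ha hb

theorem dir_inj {i j : Fin n} (h : dir i = dir j) : i = j :=
  Fin.ext (natCast_inj_of_lt (by omega) (by omega) h)

theorem dir_ne_dir_add_half (i j : Fin n) : dir i ≠ dir j + (n : ZMod (2 * n)) := by
  intro h
  have h' : (((i : ℕ) : ℕ) : ZMod (2 * n)) = ((j + n : ℕ) : ZMod (2 * n)) := by
    push_cast; exact h
  have := natCast_inj_of_lt (by omega) (by omega) h'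
  omega

theorem eq_dir_or_eq_dir_add_half [NeZero n] (a : ZMod (2 * n)) :
    ∃ m : Fin n, a = dir m ∨ a = dir m + (n : ZMod (2 * n)) := by
  have ha := ZMod.val_lt a
  have hv : ((a.val : ℕ) : ZMod (2 * n)) = a := ZMod.natCast_zmod_val a
  by_cases h : a.val < n
  · exact ⟨⟨a.val, h⟩, Or.inl hv.symm⟩
  · refine ⟨⟨a.val - n, by omega⟩, Or.inr ?_⟩
    rw [dir, ← Nat.cast_add, Nat.sub_add_cancel (by omega), hv]

/-! ## Lifted steps and the characters of `ℤⁿ` that diagonalize the substitution -/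

theorem step_dir (m : Fin n) : step (dir m) = Pi.single m 1 := by
  funext m'
  by_cases h : m' = m
  · subst h; simp [step]
  · have h1 : dir m ≠ dir m' := fun e => h (dir_inj e).symm
    simp [step, h, h1, dir_ne_dir_add_half]

theorem step_add_half [NeZero n] (a : ZMod (2 * n)) :
    step (a + (n : ZMod (2 * n))) = -step a := by
  have h2 := half_add_half (n := n)
  funext m
  have e1 : a + (n : ZMod (2 * n)) = dir m ↔ a = dir m + (n : ZMod (2 * n)) :=
    ⟨fun h => by linear_combination h - h2, fun h => by linear_combination h + h2⟩
  have e2 : a + (n : ZMod (2 * n)) = dir m + (n : ZMod (2 * n)) ↔ a = dir m := add_left_inj _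
  have e3 := dir_ne_dir_add_half m m
  simp only [step, e1, e2, Pi.neg_apply]
  by_cases h : a = dir m
  · subst h; simp [e3]
  · rw [if_neg h, if_neg h]
    split_ifs <;> rfl

/-- The additive character of `ℤⁿ` with `e_m ↦ exp(𝐢 π c m / n)`. -/
def charLift (c : ZMod (2 * n)) : (Fin n → ℤ) →+ ℂ where
  toFun x := ∑ m, (x m : ℂ) * vec n (c * dir m)
  map_zero' := by simp
  map_add' x y := by simp [add_mul, Finset.sum_add_distrib]

theorem charLift_apply (c : ZMod (2 * n)) (x : Fin n → ℤ) :
    charLift c x = ∑ m, (x m : ℂ) * vec n (c * dir m) := rfl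

/-- Oddness of the index is what matters: it gives `c * n = n` modulo `2n`, so opposite directions
get opposite values on both sides. -/
theorem charLift_step [NeZero n] (k : ℕ) (a : ZMod (2 * n)) :
    charLift ((2 * k + 1 : ℕ) : ZMod (2 * n)) (step a) =
      vec n (((2 * k + 1 : ℕ) : ZMod (2 * n)) * a) := by
  have key : ∀ m : Fin n, charLift ((2 * k + 1 : ℕ) : ZMod (2 * n)) (step (dir m)) =
      vec n (((2 * k + 1 : ℕ) : ZMod (2 * n)) * dir m) := by
    intro m
    rw [charLift_apply, step_dir, Finset.sum_eq_single m]
    · simp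
    · intro b _ hb; simp [hb]
    · simp
  obtain ⟨m, rfl | rfl⟩ := eq_dir_or_eq_dir_add_half a
  · exact key m
  · rw [step_add_half, map_neg, key, mul_add, odd_mul_half, vec_add_half]

/-- A geometric sum whose ratio `vec n (2 * d)` is an `n`-th root of unity, different from 1 unless
`i = j`. -/
theorem sum_vec_odd_mul [NeZero n] (i j : Fin n) :
    ∑ k ∈ Finset.range n, vec n (((2 * k + 1 : ℕ) : ZMod (2 * n)) * (dir i - dir j)) =
      if i = j then (n : ℂ) else 0 := by
  set d : ZMod (2 * n) := dir i - dir j with hd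
  have e : ∀ k : ℕ, vec n (((2 * k + 1 : ℕ) : ZMod (2 * n)) * d) =
      vec n (2 * d) ^ k * vec n d := by
    intro k
    rw [← vec_natCast_mul, ← vec_add]
    congr 1
    push_cast; ring
  simp_rw [e]
  split_ifs with h
  · subst h
    simp [hd, vec_zero]
  · have h1 : vec n (2 * d) ≠ 1 := by
      rw [Ne, vec_eq_one_iff]
      intro h0
      have : ((2 * i : ℕ) : ZMod (2 * n)) = ((2 * j : ℕ) : ZMod (2 * n)) := by
        push_cast
        have : (2 : ZMod (2 * n)) * ((i : ℕ) - (j : ℕ)) = 0 := h0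
        linear_combination this
      have := natCast_inj_of_lt (by omega) (by omega) this
      exact h (Fin.ext (by omega))
    have h2 : vec n (2 * d) ^ n = 1 := by
      rw [← vec_natCast_mul, vec_eq_one_iff]
      linear_combination d * half_add_half (n := n)
    rw [← Finset.sum_mul, geom_sum_eq h1, h2]
    simp

/-- The characters `charLift c`, for `c` odd, determine a vector of `ℤⁿ`. -/
theorem charLift_inversion [NeZero n] (x : Fin n → ℤ) (j : Fin n) :
    ∑ k ∈ Finset.range n, charLift ((2 * k + 1 : ℕ) : ZMod (2 * n)) x *
      vec n (-(((2 * k + 1 : ℕ) : ZMod (2 * n)) * dir j)) = n * (x j : ℂ) := by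
  simp_rw [charLift_apply, Finset.sum_mul]
  rw [Finset.sum_comm]
  have : ∀ m : Fin n, ∑ k ∈ Finset.range n,
      (x m : ℂ) * vec n (((2 * k + 1 : ℕ) : ZMod (2 * n)) * dir m) *
        vec n (-(((2 * k + 1 : ℕ) : ZMod (2 * n)) * dir j)) =
      (x m : ℂ) * if m = j then (n : ℂ) else 0 := by
    intro m
    rw [← sum_vec_odd_mul, Finset.mul_sum]
    refine Finset.sum_congr rfl fun k _ => ?_
    rw [mul_assoc, ← vec_add]
    congr 2
    ring
  simp_rw [this]
  simp [mul_comm]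

/-! ## Eigenvalues of a word -/

/-- The contribution of a letter to the eigenvalue of index `c`. -/
def letterEigenvalue (c : ZMod (2 * n)) (a : ℕ) : ℂ :=
  if a = 0 then 1 else vec n (c * (a / 2 : ℕ)) + vec n (-(c * (a / 2 : ℕ)))

/-- The eigenvalue of index `c` of the abelianized action of the word `u`. -/
def wordEigenvalue (c : ZMod (2 * n)) (u : List ℕ) : ℂ := (u.map (letterEigenvalue c)).sum

theorem sum_map_eq_sum_count (f : ℕ → ℂ) (u : List ℕ) (hn : Even n)
    (hu : ∀ a ∈ u, a ∈ alphabet n) :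
    (u.map f).sum = ∑ i : Fin (n / 2), (u.count (2 * (i : ℕ)) : ℂ) * f (2 * i) := by
  induction u with
  | nil => simp
  | cons a u ih =>
    have ha := hu a (by simp)
    obtain ⟨⟨b, hb⟩, han⟩ := ha
    obtain ⟨m, hm⟩ := hn
    have hbn : b < n / 2 := by omega
    rw [List.map_cons, List.sum_cons, ih fun x hx => hu x (by simp [hx])]
    simp_rw [List.count_cons, Nat.cast_add, add_mul, Finset.sum_add_distrib]
    rw [add_comm, Finset.sum_eq_single (⟨b, hbn⟩ : Fin (n / 2)) (f := fun i : Fin (n / 2) =>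
      ((if (a == 2 * (i : ℕ)) = true then 1 else 0 : ℕ) : ℂ) * f (2 * i))]
    · simp [hb, ← two_mul]
    · intro i _ hi
      have : a ≠ 2 * (i : ℕ) := fun h => hi (Fin.ext (by simp; omega))
      simp [this]
    · simp

/-- Orthogonality of the cosine vectors. -/
theorem sum_cos_mul_letterEigenvalue [NeZero n] (hn : Even n) (k : ℕ) (hk : 1 ≤ k)
    (hkn : k + 2 ≤ n) :
    ∑ i : Fin (n / 2), (Real.cos (((i : ℕ) : ℝ) * Real.pi / n) : ℂ) *
      letterEigenvalue ((2 * k + 1 : ℕ) : ZMod (2 * n)) (2 * i) = 0 := by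
  obtain ⟨m, hm⟩ := hn
  have hm2 : n / 2 = m := by omega
  set c : ZMod (2 * n) := ((2 * k + 1 : ℕ) : ZMod (2 * n)) with hc
  have h2 := half_add_half (n := n)
  have hcn : c * n = n := odd_mul_half k
  -- `h` is twice a cosine. The product `H` is summed over the full period `n`, and the half sum is
  -- then recovered from the symmetry `i ↦ n - i`.
  let h : ZMod (2 * n) → ℂ := fun x => vec n x + vec n (-x)
  let H : ℕ → ℂ := fun i => h i * h (c * i)
  have hneg : ∀ x, h (-x) = h x := fun x => by simp only [h, neg_neg]; ring
  have hhalf : ∀ x, h (x + n) = -h x := fun x => by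
    simp only [h]
    rw [vec_add_half, show -(x + (n : ZMod (2 * n))) = -x + n by linear_combination -h2,
      vec_add_half]
    ring
  have hcos : ∀ i : ℕ, h i = 2 * (Real.cos ((i : ℝ) * Real.pi / n) : ℂ) := fun i => by
    simp only [h]
    rw [vec_neg, Complex.add_conj, vec_natCast_re]
    push_cast; ring
  have hHm : H m = 0 := by
    have : h (m : ZMod (2 * n)) = 0 := by
      have e : (m : ZMod (2 * n)) = -(m : ZMod (2 * n)) + n := by
        have : (n : ZMod (2 * n)) = m + m := by rw [hm]; push_cast; ring
        linear_combination -this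
      have e2 := hhalf (-(m : ZMod (2 * n)))
      rw [← e, hneg] at e2
      linear_combination e2 / 2
    simp only [H, this, zero_mul]
  have hrefl : ∀ i ≤ n, H (n - i) = H i := by
    intro i hi
    have e1 : ((n - i : ℕ) : ZMod (2 * n)) = -(i : ZMod (2 * n)) + n := by
      rw [Nat.cast_sub hi]; ring
    have e2 : c * ((n - i : ℕ) : ZMod (2 * n)) = -(c * i) + n := by
      rw [e1]; linear_combination hcn
    simp only [H]
    rw [e2, e1, hhalf, hhalf, hneg, hneg]; ring
  have geom : ∀ e : ZMod (2 * n), e ≠ 0 → (n : ZMod (2 * n)) * e = 0 →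
      ∑ i ∈ Finset.range n, vec n (i * e) = 0 := by
    intro e he hne
    simp_rw [vec_natCast_mul]
    rw [geom_sum_eq (by rwa [Ne, vec_eq_one_iff]), ← vec_natCast_mul, hne, vec_zero]
    simp
  -- The bounds on `k` exclude exactly `c = -1` and `c = 1`, the two indices attached to the slope.
  have ne1 : 1 + c ≠ 0 := by
    intro h0
    have : ((2 * k + 2 : ℕ) : ZMod (2 * n)) = ((0 : ℕ) : ZMod (2 * n)) := by
      rw [hc] at h0; push_cast at h0 ⊢; linear_combination h0
    have := natCast_inj_of_lt (by omega) (by omega) this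
    omega
  have ne2 : 1 - c ≠ 0 := by
    intro h0
    have : ((2 * k : ℕ) : ZMod (2 * n)) = ((0 : ℕ) : ZMod (2 * n)) := by
      rw [hc] at h0; push_cast at h0 ⊢; linear_combination -h0
    have := natCast_inj_of_lt (by omega) (by omega) this
    omega
  have full : ∑ i ∈ Finset.range n, H i = 0 := by
    have e : ∀ i : ℕ, H i = vec n (i * (1 + c)) + vec n (i * (1 - c)) + vec n (i * (-(1 - c))) +
        vec n (i * (-(1 + c))) := by
      intro i
      simp only [H, h]
      rw [show (i : ZMod (2 * n)) * (1 + c) = i + c * i by ring,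
        show (i : ZMod (2 * n)) * (1 - c) = i + -(c * i) by ring,
        show (i : ZMod (2 * n)) * -(1 - c) = -i + c * i by ring,
        show (i : ZMod (2 * n)) * -(1 + c) = -i + -(c * i) by ring]
      simp only [vec_add]
      ring
    simp_rw [e, Finset.sum_add_distrib]
    have z1 : (n : ZMod (2 * n)) * (1 + c) = 0 := by linear_combination hcn + h2
    have z2 : (n : ZMod (2 * n)) * (1 - c) = 0 := by linear_combination -hcn
    rw [geom _ ne1 z1, geom _ ne2 z2, geom _ (neg_ne_zero.2 ne1) (by rw [mul_neg, z1, neg_zero]),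
      geom _ (neg_ne_zero.2 ne2) (by rw [mul_neg, z2, neg_zero])]
    simp
  -- The reflection fixes `m`, where `H` vanishes because `cos(π/2) = 0`; only the term at `0` is
  -- left unpaired.
  have fold : 2 * ∑ i ∈ Finset.range m, H i = H 0 := by
    have e1 : ∑ i ∈ Finset.range n, H i =
        ∑ i ∈ Finset.range m, H i + ∑ i ∈ Finset.range m, H (m + i) := by
      rw [← Finset.sum_range_add, ← hm]
    have e2 : ∑ i ∈ Finset.range m, H (m + i) = ∑ i ∈ Finset.range m, H (i + 1) := by
      rw [← Finset.sum_range_reflect]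
      refine Finset.sum_congr rfl fun i hi => ?_
      have := Finset.mem_range.1 hi
      rw [← hrefl (i + 1) (by omega)]
      congr 1
      omega
    have e3 := Finset.sum_range_succ H m
    have e4 := Finset.sum_range_succ' H m
    linear_combination full - e1 - e2 - e3 + e4 - hHm
  -- The letter `0` weighs 1 where the cosine formula would give 2; this correction cancels the
  -- unpaired term of `fold`.
  have term : ∀ i : ℕ, (Real.cos ((i : ℝ) * Real.pi / n) : ℂ) * letterEigenvalue c (2 * i) =
      H i / 2 - if i = 0 then H 0 / 4 else 0 := by
    intro i
    by_cases hi : i = 0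
    · subst hi
      simp only [letterEigenvalue, H, h]
      simp [vec_zero]
      norm_num
    · simp only [H]
      rw [hcos]
      simp [letterEigenvalue, hi, h]
      ring
  rw [Fin.sum_univ_eq_sum_range (fun i : ℕ => (Real.cos ((i : ℝ) * Real.pi / n) : ℂ) *
    letterEigenvalue c (2 * i)), hm2]
  simp_rw [term]
  have hm0 : m ≠ 0 := by have := NeZero.ne n; omega
  rw [Finset.sum_sub_distrib, ← Finset.sum_div, Finset.sum_ite_eq',
    if_pos (Finset.mem_range.2 (Nat.pos_of_ne_zero hm0))]
  linear_combination fold / 4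

theorem norm_letterEigenvalue_le (c : ZMod (2 * n)) (a : ℕ) : ‖letterEigenvalue c a‖ ≤ 2 := by
  rw [letterEigenvalue]
  split_ifs
  · simp
  · refine (norm_add_le _ _).trans ?_
    rw [norm_vec, norm_vec]; norm_num

/-- The eigenvalue is a linear form in `[u]` that vanishes on `γ`, so only the residue `[u] - sγ`
contributes: `n/2` coordinates smaller than `1/n`, with coefficients at most 2. -/
theorem norm_wordEigenvalue_lt_one [NeZero n] (hn : Even n) (u : List ℕ)
    (hu : ∀ a ∈ u, a ∈ alphabet n)
    (hd : Metric.infDist (abelianized n u) (Submodule.span ℝ {gammaVec n} :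
      Set (EuclideanSpace ℝ (Fin (n / 2)))) < 1 / n)
    (k : ℕ) (hk : 1 ≤ k) (hkn : k + 2 ≤ n) :
    ‖wordEigenvalue ((2 * k + 1 : ℕ) : ZMod (2 * n)) u‖ < 1 := by
  have hn0 : (0 : ℝ) < n := by exact_mod_cast NeZero.pos n
  have hn2 : 0 < n / 2 := by omega
  have : Nonempty (Fin (n / 2)) := ⟨⟨0, hn2⟩⟩
  obtain ⟨y, hy, hyd⟩ := (Metric.infDist_lt_iff ⟨0, Submodule.zero_mem _⟩).1 hd
  obtain ⟨s, rfl⟩ := Submodule.mem_span_singleton.1 hy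
  have horth := sum_cos_mul_letterEigenvalue hn k hk hkn
  generalize ((2 * k + 1 : ℕ) : ZMod (2 * n)) = c at horth ⊢
  have e : wordEigenvalue c u = ∑ i : Fin (n / 2),
      ((abelianized n u - s • gammaVec n) i : ℂ) * letterEigenvalue c (2 * i) := by
    rw [wordEigenvalue, sum_map_eq_sum_count _ _ hn hu, ← sub_zero (Finset.sum _ _),
      ← mul_zero (s : ℂ), ← horth, Finset.mul_sum,
      ← Finset.sum_sub_distrib]
    refine Finset.sum_congr rfl fun i _ => ?_
    simp [abelianized, gammaVec]
    ring
  rw [dist_eq_norm] at hyd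
  calc ‖wordEigenvalue c u‖ ≤ ∑ i : Fin (n / 2),
        ‖((abelianized n u - s • gammaVec n) i : ℂ) * letterEigenvalue c (2 * i)‖ := by
          rw [e]; exact norm_sum_le _ _
    _ < ∑ i : Fin (n / 2), (1 / n : ℝ) * 2 := by
        refine Finset.sum_lt_sum_of_nonempty Finset.univ_nonempty fun i _ => ?_
        rw [norm_mul, Complex.norm_real]
        have h1 := (PiLp.norm_apply_le (abelianized n u - s • gammaVec n) i).trans_lt hyd
        have h2 := norm_letterEigenvalue_le c (2 * i)
        nlinarith [norm_nonneg ((abelianized n u - s • gammaVec n) i)]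
    _ ≤ 1 := by
        rw [Finset.sum_const, Finset.card_univ, Fintype.card_fin, nsmul_eq_mul]
        have : ((n / 2 : ℕ) : ℝ) * 2 ≤ n := by
          exact_mod_cast (show n / 2 * 2 ≤ n by omega)
        rw [show ((n / 2 : ℕ) : ℝ) * (1 / n * 2) = ((n / 2 : ℕ) : ℝ) * 2 / n by ring, div_le_one hn0]
        exact this

theorem two_div_le_letterEigenvalue_re [NeZero n] (hn4 : 4 ≤ n) {a : ℕ} (ha : a ∈ alphabet n) :
    2 / (n : ℝ) ≤ (letterEigenvalue (1 : ZMod (2 * n)) a).re := by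
  have hn0 : (4 : ℝ) ≤ n := by exact_mod_cast hn4
  obtain ⟨⟨b, hb⟩, han⟩ := ha
  rw [letterEigenvalue]
  split_ifs with h0
  · rw [div_le_iff₀ (by linarith)]; rw [Complex.one_re]; linarith
  · rw [one_mul, vec_neg, Complex.add_conj, vec_natCast_re, Complex.ofReal_re]
    have hab : a / 2 = b := by omega
    rw [hab]
    have hbn : (2 * b + 1 : ℝ) ≤ n := by exact_mod_cast (by omega : 2 * b + 1 ≤ n)
    have hpi := Real.pi_pos
    -- Concavity of the cosine on `[0, π/2]`: it lies above the chord `1 - 2x/π`, which is at least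
    -- `1/n` here since `2b < n`.
    have hcos := Real.one_sub_mul_le_cos (x := b * Real.pi / n) (by positivity)
      (by rw [div_le_div_iff₀ (by linarith) two_pos]; nlinarith)
    have e : 2 / Real.pi * (b * Real.pi / n) = 2 * b / n := by field_simp
    have h1 : (1 : ℝ) / n ≤ 1 - 2 * b / n := by
      rw [div_le_iff₀ (by linarith), sub_mul, div_mul_cancel₀ _ (by linarith)]
      linarith
    rw [e] at hcos
    have e2 : (2 : ℝ) / n = 2 * (1 / n) := by ring
    rw [e2]
    linarith

theorem two_mul_length_div_le_wordEigenvalue_re [NeZero n] (hn4 : 4 ≤ n) (u : List ℕ)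
    (hu : ∀ a ∈ u, a ∈ alphabet n) :
    2 / (n : ℝ) * u.length ≤ (wordEigenvalue (1 : ZMod (2 * n)) u).re := by
  induction u with
  | nil => simp [wordEigenvalue]
  | cons a u ih =>
    have h1 := two_div_le_letterEigenvalue_re hn4 (hu a (by simp))
    have h2 := ih fun x hx => hu x (by simp [hx])
    rw [wordEigenvalue] at h2 ⊢
    rw [List.map_cons, List.sum_cons, Complex.add_re, List.length_cons]
    push_cast
    linarith

/-! ## Corners, edges and edge paths -/

theorem Tile.IsCorner.symm {τ : Tile n} {q : ℂ} {a b : ZMod (2 * n)} (h : τ.IsCorner q a b) :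
    τ.IsCorner q b a := by
  obtain ⟨s, t, hs, ht, hq, hab⟩ := h
  exact ⟨s, t, hs, ht, hq, hab.symm.imp (fun h => ⟨h.2, h.1⟩) fun h => ⟨h.2, h.1⟩⟩

theorem vec_add_mul_half [NeZero n] (a : ZMod (2 * n)) {s : ℕ} (hs : s ≤ 1) :
    vec n (a + ((s * n : ℕ) : ZMod (2 * n))) = (1 - 2 * s) * vec n a := by
  interval_cases s
  · simp
  · rw [one_mul, vec_add_half]; push_cast; ring

theorem add_mul_half_add_half (a : ZMod (2 * n)) {s : ℕ} (hs : s ≤ 1) :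
    a + ((s * n : ℕ) : ZMod (2 * n)) + n = a + (((1 - s) * n : ℕ) : ZMod (2 * n)) := by
  interval_cases s
  · simp
  · simp [add_assoc, half_add_half]

theorem Tile.IsCorner.next [NeZero n] {τ : Tile n} {q : ℂ} {a b : ZMod (2 * n)}
    (h : τ.IsCorner q a b) : τ.IsCorner (q + vec n a) (a + n) b := by
  obtain ⟨s, t, hs, ht, rfl, ⟨rfl, rfl⟩ | ⟨rfl, rfl⟩⟩ := h
  · refine ⟨1 - s, t, by omega, ht, ?_, Or.inl ⟨add_mul_half_add_half _ hs, rfl⟩⟩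
    rw [vec_add_mul_half _ hs, Nat.cast_sub hs]
    push_cast; ring
  · refine ⟨s, 1 - t, hs, by omega, ?_, Or.inr ⟨add_mul_half_add_half _ ht, rfl⟩⟩
    rw [vec_add_mul_half _ ht, Nat.cast_sub ht]
    push_cast; ring

theorem Tile.HasEdge.reverse [NeZero n] {τ : Tile n} {q : ℂ} {a : ZMod (2 * n)}
    (h : τ.HasEdge q a) : τ.HasEdge (q + vec n a) (a + n) := by
  obtain ⟨b, h⟩ := h
  exact ⟨b, h.next⟩

theorem Tile.hasEdge_translate {τ : Tile n} {q : ℂ} {a : ZMod (2 * n)} (c : ℂ) :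
    (τ.translate c).HasEdge (c + q) a ↔ τ.HasEdge q a := by
  simp only [Tile.HasEdge, Tile.IsCorner, Tile.translate, add_assoc, add_right_inj]

theorem Tile.hasEdge_pos (τ : Tile n) : τ.HasEdge τ.pos (dir τ.proto.i) :=
  ⟨dir τ.proto.j, 0, 0, by simp⟩

theorem hasEdge_reverse [NeZero n] {S : Set (Tile n)} {q : ℂ} {a : ZMod (2 * n)}
    (h : HasEdge S q a) : HasEdge S (q + vec n a) (a + n) := by
  obtain ⟨τ, hτ, h⟩ := h
  exact ⟨τ, hτ, h.reverse⟩

theorem finite_hasVertex {S : Set (Tile n)} (hS : S.Finite) : {q | HasVertex S q}.Finite := by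
  refine (hS.biUnion fun τ _ => (Set.toFinite (((fun x : ℕ × ℕ => τ.pos +
    (x.1 : ℂ) * vec n (dir τ.proto.i) + (x.2 : ℂ) * vec n (dir τ.proto.j)) ''
      (Set.Iic 1 ×ˢ Set.Iic 1))))).subset ?_
  rintro q ⟨τ, hτ, a, b, s, t, hs, ht, hq, -⟩
  exact Set.mem_biUnion hτ ⟨(s, t), ⟨hs, ht⟩, hq.symm⟩

theorem displacement_nil : displacement ([] : List (ZMod (2 * n))) = 0 := rfl

theorem displacement_cons (a : ZMod (2 * n)) (l : List (ZMod (2 * n))) :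
    displacement (a :: l) = vec n a + displacement l := by
  simp [displacement]

theorem displacement_append (l l' : List (ZMod (2 * n))) :
    displacement (l ++ l') = displacement l + displacement l' := by
  simp [displacement]

/-- The displacement in `ℤⁿ` of the lift of an edge path. -/
def liftDisplacement (l : List (ZMod (2 * n))) : Fin n → ℤ := (l.map step).sum

theorem liftDisplacement_nil : liftDisplacement ([] : List (ZMod (2 * n))) = 0 := rfl

theorem liftDisplacement_cons (a : ZMod (2 * n)) (l : List (ZMod (2 * n))) :
    liftDisplacement (a :: l) = step a + liftDisplacement l := by
  simp [liftDisplacement]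

theorem liftDisplacement_append (l l' : List (ZMod (2 * n))) :
    liftDisplacement (l ++ l') = liftDisplacement l + liftDisplacement l' := by
  simp [liftDisplacement]

/-- The reversed edge path. -/
def reversePath (l : List (ZMod (2 * n))) : List (ZMod (2 * n)) :=
  (l.map (· + (n : ZMod (2 * n)))).reverse

theorem reversePath_cons (a : ZMod (2 * n)) (l : List (ZMod (2 * n))) :
    reversePath (a :: l) = reversePath l ++ [a + (n : ZMod (2 * n))] := by
  simp [reversePath]

theorem displacement_reversePath [NeZero n] (l : List (ZMod (2 * n))) :
    displacement (reversePath l) = -displacement l := by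
  induction l with
  | nil => simp [reversePath, displacement]
  | cons a l ih =>
    rw [reversePath_cons, displacement_append, ih, displacement_cons, displacement_cons,
      displacement_nil, vec_add_half]
    ring

theorem liftDisplacement_reversePath [NeZero n] (l : List (ZMod (2 * n))) :
    liftDisplacement (reversePath l) = -liftDisplacement l := by
  induction l with
  | nil => simp [reversePath, liftDisplacement]
  | cons a l ih =>
    rw [reversePath_cons, liftDisplacement_append, ih, liftDisplacement_cons,
      liftDisplacement_cons, liftDisplacement_nil, step_add_half]
    abel

theorem IsEdgePath.mono {S S' : Set (Tile n)} (h : S ⊆ S') :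
    ∀ {l : List (ZMod (2 * n))} {q : ℂ}, IsEdgePath S q l → IsEdgePath S' q l
  | [], _, _ => trivial
  | _ :: _, _, ⟨⟨τ, hτ, he⟩, hl⟩ => ⟨⟨τ, h hτ, he⟩, hl.mono h⟩

theorem isEdgePath_append {S : Set (Tile n)} {l l' : List (ZMod (2 * n))} {q : ℂ} :
    IsEdgePath S q (l ++ l') ↔ IsEdgePath S q l ∧ IsEdgePath S (q + displacement l) l' := by
  induction l generalizing q with
  | nil => simp [IsEdgePath, displacement_nil]
  | cons a l ih => simp [IsEdgePath, ih, displacement_cons, add_assoc, and_assoc]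

theorem IsEdgePath.reverse [NeZero n] {S : Set (Tile n)} {l : List (ZMod (2 * n))} {q : ℂ}
    (h : IsEdgePath S q l) : IsEdgePath S (q + displacement l) (reversePath l) := by
  induction l generalizing q with
  | nil => trivial
  | cons a l ih =>
    rw [reversePath_cons, isEdgePath_append, displacement_cons, ← add_assoc,
      displacement_reversePath, add_neg_cancel_right]
    exact ⟨ih h.2, hasEdge_reverse h.1, trivial⟩

theorem IsEdgePath.translate {S : Set (Tile n)} {l : List (ZMod (2 * n))} {q : ℂ} (c : ℂ)
    (h : IsEdgePath S q l) : IsEdgePath (Tile.translate c '' S) (c + q) l := by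
  induction l generalizing q with
  | nil => trivial
  | cons a l ih =>
    obtain ⟨⟨τ, hτ, he⟩, hl⟩ := h
    refine ⟨⟨_, ⟨τ, hτ, rfl⟩, (Tile.hasEdge_translate c).2 he⟩, ?_⟩
    rw [add_assoc]
    exact ih hl

theorem IsEdgePath.exists_finite {S : Set (Tile n)} {l : List (ZMod (2 * n))} {q : ℂ}
    (h : IsEdgePath S q l) : ∃ F ⊆ S, F.Finite ∧ IsEdgePath F q l := by
  induction l generalizing q with
  | nil => exact ⟨∅, Set.empty_subset _, Set.finite_empty, trivial⟩
  | cons a l ih =>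
    obtain ⟨⟨τ, hτ, he⟩, hl⟩ := h
    obtain ⟨F, hFS, hF, hFl⟩ := ih hl
    exact ⟨insert τ F, Set.insert_subset hτ hFS, hF.insert τ, ⟨τ, Set.mem_insert _ _, he⟩,
      hFl.mono (Set.subset_insert _ _)⟩

theorem IsEdgePath.hasVertex_start {S : Set (Tile n)} {a : ZMod (2 * n)}
    {l : List (ZMod (2 * n))} {q : ℂ} (h : IsEdgePath S q (a :: l)) : HasVertex S q := by
  obtain ⟨⟨τ, hτ, he⟩, -⟩ := h
  exact ⟨τ, hτ, a, he⟩

theorem IsEdgePath.hasVertex_end [NeZero n] {S : Set (Tile n)} {a : ZMod (2 * n)}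
    {l : List (ZMod (2 * n))} {q : ℂ} (h : IsEdgePath S q (a :: l)) :
    HasVertex S (q + displacement (a :: l)) := by
  induction l generalizing a q with
  | nil =>
    rw [displacement_cons, displacement_nil, add_zero]
    obtain ⟨τ, hτ, he⟩ := hasEdge_reverse h.1
    exact ⟨τ, hτ, _, he⟩
  | cons b l ih =>
    rw [displacement_cons, ← add_assoc]
    exact ih h.2

/-! ## Lifts of edge paths -/

/-- Every closed edge path of `S` is lifted to a closed path. -/
def HasClosedLifts (S : Set (Tile n)) : Prop :=
  ∀ q l, IsEdgePath S q l → displacement l = 0 → liftDisplacement l = 0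

theorem HasClosedLifts.eq [NeZero n] {S : Set (Tile n)} (hS : HasClosedLifts S) {q : ℂ}
    {l l' : List (ZMod (2 * n))} (h : IsEdgePath S q l) (h' : IsEdgePath S q l')
    (e : displacement l = displacement l') : liftDisplacement l = liftDisplacement l' := by
  have := hS q (l ++ reversePath l') (isEdgePath_append.2 ⟨h, by rw [e]; exact h'.reverse⟩)
    (by rw [displacement_append, displacement_reversePath, e, add_neg_cancel])
  rwa [liftDisplacement_append, liftDisplacement_reversePath, add_neg_eq_zero] at this

/-- A cancelled pair has opposite steps, and a flip only permutes two steps of a commutative sum.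
Lifting is therefore a homotopy invariant. -/
theorem ElementaryHomotopy.liftDisplacement_eq [NeZero n] {S : Set (Tile n)} {q : ℂ}
    {l l' : List (ZMod (2 * n))} (h : ElementaryHomotopy S q l l') :
    liftDisplacement l = liftDisplacement l' := by
  cases h with
  | cancel l l' a h =>
    simp only [liftDisplacement_append, liftDisplacement_cons, step_add_half]
    abel
  | flip l l' a b τ hτ h =>
    simp only [liftDisplacement_append, liftDisplacement_cons]
    abel

theorem IsSimplyConnectedSet.hasClosedLifts [NeZero n] {S : Set (Tile n)}
    (hS : IsSimplyConnectedSet S) : HasClosedLifts S := by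
  intro q l hl h0
  cases l with
  | nil => rfl
  | cons a l =>
    have h := hS.2 q hl.hasVertex_start _ hl h0
    have key : ∀ {l l'}, Relation.EqvGen (ElementaryHomotopy S q) l l' →
        liftDisplacement l = liftDisplacement l' := by
      intro l l' h
      induction h with
      | rel _ _ h => exact h.liftDisplacement_eq
      | refl => rfl
      | symm _ _ _ ih => exact ih.symm
      | trans _ _ _ _ _ ih1 ih2 => exact ih1.trans ih2
    exact key h

/-- A set of tiles whose closed paths have closed lifts can be lifted. -/
theorem HasClosedLifts.exists_lift [NeZero n] {S : Set (Tile n)} (hS : HasClosedLifts S) :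
    ∃ L : ℂ → Fin n → ℤ, (∀ q a, HasEdge S q a → L (q + vec n a) = L q + step a) ∧
      ∀ p, ∃ q l, IsEdgePath S q l ∧ L p = liftDisplacement l := by
  -- The classes are the edge path components. Each gets its own base point `rep`, so connectedness
  -- is not needed.
  let r : Setoid ℂ :=
    { r := fun p q => ∃ l, IsEdgePath S p l ∧ p + displacement l = q
      iseqv :=
        { refl := fun p => ⟨[], trivial, by simp [displacement]⟩
          symm := by
            rintro p _ ⟨l, hl, rfl⟩
            exact ⟨reversePath l, hl.reverse, by rw [displacement_reversePath]; ring⟩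
          trans := by
            rintro p _ _ ⟨l, hl, rfl⟩ ⟨l', hl', rfl⟩
            exact ⟨l ++ l', isEdgePath_append.2 ⟨hl, hl'⟩, by
              rw [displacement_append, add_assoc]⟩ } }
  let rep : ℂ → ℂ := fun p => (Quotient.mk r p).out
  have hrep : ∀ p, ∃ l, IsEdgePath S (rep p) l ∧ rep p + displacement l = p := fun p =>
    Quotient.exact (s := r) (Quotient.out_eq _)
  choose path hpath hend using hrep
  refine ⟨fun p => liftDisplacement (path p), fun q a h => ?_, fun p => ⟨rep p, path p, hpath p, rfl⟩⟩
  have e : rep (q + vec n a) = rep q := by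
    have : Quotient.mk r (q + vec n a) = Quotient.mk r q :=
      (Quotient.sound (s := r) ⟨[a], ⟨h, trivial⟩, by simp [displacement]⟩).symm
    simp only [rep, this]
  have h1 : IsEdgePath S (rep q) (path q ++ [a]) :=
    isEdgePath_append.2 ⟨hpath q, by rw [hend]; exact ⟨h, trivial⟩⟩
  have h2 : IsEdgePath S (rep q) (path (q + vec n a)) := by rw [← e]; exact hpath _
  have h3 : displacement (path (q + vec n a)) = displacement (path q ++ [a]) := by
    have e1 := hend q
    have e2 := hend (q + vec n a)
    rw [e] at e2
    rw [displacement_append, displacement_cons, displacement_nil]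
    linear_combination e2 - e1
  change liftDisplacement (path (q + vec n a)) = liftDisplacement (path q) + step a
  rw [hS.eq h2 h1 h3, liftDisplacement_append, liftDisplacement_cons, liftDisplacement_nil,
    add_zero]

/-- The lift of a path depends only on its endpoints, and a finite patch has finitely many pairs of
vertices. -/
theorem IsPatch.exists_norm_charLift_le [NeZero n] {S : Set (Tile n)} (hS : IsPatch S)
    (c : ZMod (2 * n)) :
    ∃ N : ℝ, ∀ q l, IsEdgePath S q l → ‖charLift c (liftDisplacement l)‖ ≤ N := by
  have hc := hS.simplyConnected.hasClosedLifts
  choose! path hpath hend using hS.simplyConnected.1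
  have hfin := finite_hasVertex hS.finite
  obtain ⟨N, hN⟩ := ((hfin.prod hfin).image fun x =>
    ‖charLift c (liftDisplacement (path x.1 x.2))‖).bddAbove
  -- The `0` serves the empty path, which may start away from the vertices of `S`.
  refine ⟨max N 0, fun q l hl => ?_⟩
  cases l with
  | nil => simp [liftDisplacement_nil]
  | cons a l =>
    have h1 := hl.hasVertex_start
    have h2 := hl.hasVertex_end
    rw [hc.eq hl (hpath _ _ h1 h2) (add_left_cancel (hend _ _ h1 h2).symm)]
    exact (hN ⟨(_, _), ⟨h1, h2⟩, rfl⟩).trans (le_max_left _ _)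

/-! ## Edge paths along words -/

/-- The edge path along a letter: its second half goes along the far side of the rhombus. -/
def letterPath (d : ZMod (2 * n)) (a : ℕ) : List (ZMod (2 * n)) :=
  if a = 0 then [d] else
    [d + ((a / 2 : ℕ) : ZMod (2 * n)), d - ((a / 2 : ℕ) : ZMod (2 * n))]

/-- The edge path along a word. -/
def wordPath (d : ZMod (2 * n)) (u : List ℕ) : List (ZMod (2 * n)) := u.flatMap (letterPath d)

theorem wordPath_cons (d : ZMod (2 * n)) (a : ℕ) (u : List ℕ) :
    wordPath d (a :: u) = letterPath d a ++ wordPath d u := rfl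

theorem displacement_letterPath (d : ZMod (2 * n)) (a : ℕ) :
    displacement (letterPath d a) = letterVec d a := by
  rw [letterPath, letterVec]
  split_ifs <;> simp [displacement]

theorem displacement_wordPath (d : ZMod (2 * n)) (u : List ℕ) :
    displacement (wordPath d u) = wordVec d u := by
  induction u with
  | nil => rfl
  | cons a u ih =>
    rw [wordPath_cons, displacement_append, ih, displacement_letterPath]
    simp [wordVec]

/-- This is the diagonalization: the directions `d ± a/2` of a letter factor as `vec n (c * d)`
times a quantity independent of `d`. -/
theorem charLift_wordPath [NeZero n] (k : ℕ) (d : ZMod (2 * n)) (u : List ℕ) :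
    charLift ((2 * k + 1 : ℕ) : ZMod (2 * n)) (liftDisplacement (wordPath d u)) =
      wordEigenvalue ((2 * k + 1 : ℕ) : ZMod (2 * n)) u *
        charLift ((2 * k + 1 : ℕ) : ZMod (2 * n)) (step d) := by
  induction u with
  | nil => simp [wordPath, liftDisplacement, wordEigenvalue]
  | cons a u ih =>
    rw [wordPath_cons, liftDisplacement_append, map_add, ih, wordEigenvalue, wordEigenvalue,
      List.map_cons, List.sum_cons, add_mul, letterPath, letterEigenvalue]
    congr 1
    split_ifs
    · simp [liftDisplacement]
    · rw [liftDisplacement_cons, liftDisplacement_cons, liftDisplacement_nil, add_zero, map_add,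
        charLift_step, charLift_step, charLift_step, mul_add, mul_sub, sub_eq_add_neg, vec_add,
        vec_add]
      ring

theorem wordVec_eq [NeZero n] (d : ZMod (2 * n)) (u : List ℕ) :
    wordVec d u = wordEigenvalue (1 : ZMod (2 * n)) u * vec n d := by
  induction u with
  | nil => simp [wordVec, wordEigenvalue]
  | cons a u ih =>
    rw [wordVec, wordEigenvalue] at ih ⊢
    rw [List.map_cons, List.sum_cons, ih, List.map_cons, List.sum_cons, add_mul, letterVec,
      letterEigenvalue]
    congr 1
    split_ifs
    · simp
    · rw [one_mul, sub_eq_add_neg, vec_add, vec_add]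
      ring

/-! ## Paths in metatiles -/

namespace Substitution

theorem metatile_succ (σ : Substitution n) (k : ℕ) (t : Prototile n) :
    σ.metatile (k + 1) t = σ.apply (σ.metatile k t) :=
  Function.iterate_succ_apply' _ _ _

theorem imageTile_zero (σ : Substitution n) (t : Prototile n) :
    σ.imageTile ⟨0, t⟩ = σ.image t := by
  have : (Tile.translate (0 : ℂ) : Tile n → Tile n) = id := by
    funext τ; simp [Tile.translate]
  simp [imageTile, this]

theorem metatile_one (σ : Substitution n) (t : Prototile n) : σ.metatile 1 t = σ.image t := by
  rw [← imageTile_zero, metatile_succ]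
  simp [apply, metatile]

theorem imageTile_subset_apply (σ : Substitution n) {S : Set (Tile n)} {τ : Tile n} (h : τ ∈ S) :
    σ.imageTile τ ⊆ σ.apply S := Set.subset_biUnion_of_mem h

variable {σ : Substitution n} {u : List ℕ}

theorem IsDefinedBy.isPatch_image (hσ : σ.IsDefinedBy u) (t : Prototile n) :
    IsPatch (σ.image t) := by
  rw [← metatile_one]; exact hσ.patch 1 t

theorem IsDefinedBy.isEdgePath_wordPath [NeZero n] (hσ : σ.IsDefinedBy u) {t : Prototile n}
    {q : ℂ} {d : Fin n} (h : (⟨0, t⟩ : Tile n).HasEdge q (dir d)) :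
    IsEdgePath (σ.image t) (σ.factor * q) (wordPath (dir d) u) := by
  -- Induction on the remaining suffix, with the prefix kept as data because `LetterAt` refers to a
  -- splitting of the whole word.
  have key : ∀ w' w : List ℕ, u = w ++ w' →
      IsEdgePath (σ.image t) (σ.factor * q + wordVec (dir d) w) (wordPath (dir d) w') := by
    intro w'
    induction w' with
    | nil => intro _ _; trivial
    | cons a w' ih =>
      intro w hw
      rw [wordPath_cons, isEdgePath_append, displacement_letterPath]
      have hat : LetterAt u (σ.factor * q) (dir d) (σ.factor * q + wordVec (dir d) w) a :=
        ⟨w, w', hw, rfl⟩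
      constructor
      · rw [letterPath]
        split_ifs with h0
        · subst h0
          obtain ⟨τ, hτ, -⟩ := hσ.edges t q d _ h hat
          exact ⟨⟨τ, hτ⟩, trivial⟩
        · obtain ⟨τ, hτ, hc⟩ := hσ.rhombuses t q d _ a h hat h0
          exact ⟨⟨τ, hτ.1, _, hc⟩, ⟨τ, hτ.1, _, hc.next.symm⟩, trivial⟩
      · have := ih (w ++ [a]) (by simp [hw])
        rw [show wordVec (dir d) (w ++ [a]) = wordVec (dir d) w + letterVec (dir d) a by
          simp [wordVec], ← add_assoc] at this
        exact this
  have := key u [] rfl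
  rwa [show wordVec (dir d) ([] : List ℕ) = 0 from rfl, add_zero] at this

/-- One edge determines the similitude; `2 ≤ n` provides a prototile to take it from. -/
theorem IsDefinedBy.factor_eq [NeZero n] (hσ : σ.IsDefinedBy u) (hn : 2 ≤ n) :
    σ.factor = wordEigenvalue (1 : ZMod (2 * n)) u := by
  let t : Prototile n := ⟨⟨0, by omega⟩, ⟨1, by omega⟩, Nat.zero_lt_one⟩
  have h := hσ.vertices t 0 t.i (Tile.hasEdge_pos ⟨0, t⟩)
  rw [mul_zero, zero_add, zero_add, wordVec_eq] at h
  exact (mul_right_cancel₀ (vec_ne_zero _) h).symm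

theorem IsDefinedBy.exists_image_edge [NeZero n] (hσ : σ.IsDefinedBy u) (k : ℕ) {τ : Tile n}
    {q : ℂ} {a : ZMod (2 * n)} (h : τ.HasEdge q a) :
    ∃ l, IsEdgePath (σ.imageTile τ) (σ.factor * q) l ∧ displacement l = σ.factor * vec n a ∧
      charLift ((2 * k + 1 : ℕ) : ZMod (2 * n)) (liftDisplacement l) =
        wordEigenvalue ((2 * k + 1 : ℕ) : ZMod (2 * n)) u *
          charLift ((2 * k + 1 : ℕ) : ZMod (2 * n)) (step a) := by
  have pos : ∀ (q : ℂ) (d : Fin n), τ.HasEdge q (dir d) →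
      IsEdgePath (σ.imageTile τ) (σ.factor * q) (wordPath (dir d) u) ∧
        displacement (wordPath (dir d) u) = σ.factor * vec n (dir d) := by
    intro q d h
    have h' : (⟨0, τ.proto⟩ : Tile n).HasEdge (q - τ.pos) (dir d) := by
      rw [← Tile.hasEdge_translate τ.pos, add_sub_cancel]
      simpa [Tile.translate] using h
    constructor
    · have := (hσ.isEdgePath_wordPath h').translate (σ.factor * τ.pos)
      rwa [← mul_add, add_sub_cancel] at this
    · have := hσ.vertices _ _ _ h'
      rw [mul_add] at this
      rw [displacement_wordPath]
      exact add_left_cancel this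
  obtain ⟨d, rfl | rfl⟩ := eq_dir_or_eq_dir_add_half a
  · exact ⟨_, (pos q d h).1, (pos q d h).2, charLift_wordPath _ _ _⟩
  -- The word is laid out only in the directions `v_d`; an edge of direction `-v_d` is treated from
  -- its other end and the image path reversed.
  · have h' := h.reverse
    rw [add_assoc (dir d), half_add_half, add_zero, vec_add_half] at h'
    obtain ⟨h1, h2⟩ := pos _ d h'
    refine ⟨reversePath (wordPath (dir d) u), ?_, ?_, ?_⟩
    · have := h1.reverse
      rwa [h2, ← mul_add, neg_add_cancel_right] at this
    · rw [displacement_reversePath, h2, vec_add_half, mul_neg]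
    · rw [liftDisplacement_reversePath, step_add_half, map_neg, map_neg, charLift_wordPath,
        mul_neg]

theorem IsDefinedBy.exists_image_path [NeZero n] (hσ : σ.IsDefinedBy u) (k : ℕ)
    {S : Set (Tile n)} {q : ℂ} {l : List (ZMod (2 * n))} (h : IsEdgePath S q l) :
    ∃ l', IsEdgePath (σ.apply S) (σ.factor * q) l' ∧
      displacement l' = σ.factor * displacement l ∧
      charLift ((2 * k + 1 : ℕ) : ZMod (2 * n)) (liftDisplacement l') =
        wordEigenvalue ((2 * k + 1 : ℕ) : ZMod (2 * n)) u *
          charLift ((2 * k + 1 : ℕ) : ZMod (2 * n)) (liftDisplacement l) := by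
  induction l generalizing q with
  | nil => exact ⟨[], trivial, by simp [displacement], by simp [liftDisplacement]⟩
  | cons a l ih =>
    obtain ⟨⟨τ, hτ, he⟩, hl⟩ := h
    obtain ⟨l₁, p₁, d₁, c₁⟩ := hσ.exists_image_edge k he
    obtain ⟨l₂, p₂, d₂, c₂⟩ := ih hl
    refine ⟨l₁ ++ l₂, isEdgePath_append.2 ⟨p₁.mono (σ.imageTile_subset_apply hτ), ?_⟩, ?_, ?_⟩
    · rwa [d₁, ← mul_add]
    · rw [displacement_append, d₁, d₂, displacement_cons, mul_add]
    · rw [liftDisplacement_append, map_add, c₁, c₂, liftDisplacement_cons, map_add, mul_add]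

/-- This anchors each image at the image of the position of its tile, where paths between different
images can be attached. -/
theorem IsDefinedBy.hasVertex_image_zero [NeZero n] (hσ : σ.IsDefinedBy u) (hu : u ≠ [])
    (t : Prototile n) : HasVertex (σ.image t) 0 := by
  have h := hσ.isEdgePath_wordPath (Tile.hasEdge_pos ⟨0, t⟩)
  obtain ⟨a, u, rfl⟩ := List.exists_cons_of_ne_nil hu
  rw [wordPath_cons, isEdgePath_append, mul_zero] at h
  have h1 := h.1
  rw [letterPath] at h1
  split_ifs at h1 <;> exact h1.hasVertex_start

/-- Any vertex of an image is joined, inside that image, to the image of the position of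
the tile. -/
theorem IsDefinedBy.exists_path_from_image_pos [NeZero n] (hσ : σ.IsDefinedBy u) (hu : u ≠ [])
    {c : ZMod (2 * n)} {N : ℝ} (hN : ∀ t q l, IsEdgePath (σ.image t) q l →
      ‖charLift c (liftDisplacement l)‖ ≤ N)
    {S : Set (Tile n)} {p : ℂ} (hp : HasVertex (σ.apply S) p) :
    ∃ τ ∈ S, ∃ l, IsEdgePath (σ.apply S) (σ.factor * τ.pos) l ∧
      σ.factor * τ.pos + displacement l = p ∧ ‖charLift c (liftDisplacement l)‖ ≤ N := by
  obtain ⟨τ', hτ', a, he⟩ := hp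
  obtain ⟨τ, hτ, τ₀, hτ₀, rfl⟩ := Set.mem_iUnion₂.1 hτ'
  have hv : HasVertex (σ.image τ.proto) (p - σ.factor * τ.pos) := by
    refine ⟨τ₀, hτ₀, a, ?_⟩
    rw [← Tile.hasEdge_translate (σ.factor * τ.pos), add_sub_cancel]
    exact he
  obtain ⟨l, hl, hd⟩ := (hσ.isPatch_image τ.proto).simplyConnected.1 _ _
    (hσ.hasVertex_image_zero hu τ.proto) hv
  refine ⟨τ, hτ, l, ?_, ?_, hN _ _ _ hl⟩
  · have := hl.translate (σ.factor * τ.pos)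
    rw [add_zero] at this
    exact this.mono (σ.imageTile_subset_apply hτ)
  · linear_combination hd

theorem finite_prototile : Finite (Prototile n) :=
  Finite.of_injective (fun t : Prototile n => (t.i, t.j)) fun s t h => by
    cases s; cases t; simp_all

/-- Lifts of edge paths of metatiles stay bounded in the contracted directions. -/
theorem IsDefinedBy.exists_norm_charLift_le [NeZero n] (hσ : σ.IsDefinedBy u) (hu : u ≠ [])
    (k : ℕ) (hlt : ‖wordEigenvalue ((2 * k + 1 : ℕ) : ZMod (2 * n)) u‖ < 1) :
    ∃ D : ℝ, ∀ m t q l, IsEdgePath (σ.metatile m t) q l →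
      ‖charLift ((2 * k + 1 : ℕ) : ZMod (2 * n)) (liftDisplacement l)‖ ≤ D := by
  have := finite_prototile (n := n)
  set c : ZMod (2 * n) := ((2 * k + 1 : ℕ) : ZMod (2 * n))
  choose N₀ hN₀ using fun t => (hσ.patch 0 t).exists_norm_charLift_le c
  choose N₁ hN₁ using fun t => (hσ.isPatch_image t).exists_norm_charLift_le c
  obtain ⟨B₀, hB₀⟩ := (Set.finite_range N₀).bddAbove
  obtain ⟨B₁, hB₁⟩ := (Set.finite_range N₁).bddAbove
  set r := ‖wordEigenvalue c u‖
  set N := max B₁ 0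
  have hN : ∀ t q l, IsEdgePath (σ.image t) q l → ‖charLift c (liftDisplacement l)‖ ≤ N :=
    fun t q l h => (hN₁ t q l h).trans ((hB₁ ⟨t, rfl⟩).trans (le_max_left _ _))
  have hr : 0 < 1 - r := by linarith
  -- `B₀` handles the metatiles of order 0; the second term is the fixed point of `D ↦ 2N + rD`.
  set D := max B₀ (2 * N / (1 - r))
  have hD : 2 * N + r * D ≤ D := by
    have : 2 * N / (1 - r) ≤ D := le_max_right _ _
    rw [div_le_iff₀ hr] at this
    linarith
  have hN0 : 0 ≤ N := le_max_right _ _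
  have hD0 : 0 ≤ D := le_trans (by positivity) (le_max_right _ _)
  refine ⟨D, fun m => ?_⟩
  induction m with
  | zero => exact fun t q l h => (hN₀ t q l h).trans ((hB₀ ⟨t, rfl⟩).trans (le_max_left _ _))
  | succ m ih =>
    intro t q l h
    cases l with
    | nil => simpa [liftDisplacement_nil] using hD0
    | cons a l =>
      have hc := (hσ.patch (m + 1) t).simplyConnected.hasClosedLifts
      generalize hl : a :: l = l₀ at *
      have hs : HasVertex (σ.metatile (m + 1) t) q := by subst hl; exact h.hasVertex_start
      have he : HasVertex (σ.metatile (m + 1) t) (q + displacement l₀) := by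
        subst hl; exact h.hasVertex_end
      rw [metatile_succ] at hs he
      -- Both ends of the path are tied, within single images, to expanded positions of tiles. These
      -- positions are joined by `l₃` one level below, whose image `l₄` closes the loop: `l₁ ++ l₀`
      -- and `l₄ ++ l₂` have the same endpoints, hence the same lift.
      obtain ⟨τ₁, hτ₁, l₁, p₁, d₁, b₁⟩ := hσ.exists_path_from_image_pos hu hN hs
      obtain ⟨τ₂, hτ₂, l₂, p₂, d₂, b₂⟩ := hσ.exists_path_from_image_pos hu hN he
      obtain ⟨l₃, p₃, d₃⟩ := (hσ.patch m t).simplyConnected.1 τ₁.pos τ₂.pos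
        ⟨τ₁, hτ₁, _, τ₁.hasEdge_pos⟩ ⟨τ₂, hτ₂, _, τ₂.hasEdge_pos⟩
      obtain ⟨l₄, p₄, d₄, c₄⟩ := hσ.exists_image_path k p₃
      have e₄ : σ.factor * τ₁.pos + displacement l₄ = σ.factor * τ₂.pos := by
        rw [d₄, ← mul_add, d₃]
      rw [← metatile_succ] at p₁ p₂ p₄
      have e := hc.eq (l := l₁ ++ l₀) (l' := l₄ ++ l₂) (isEdgePath_append.2 ⟨p₁, by rwa [d₁]⟩)
        (isEdgePath_append.2 ⟨p₄, by rwa [e₄]⟩)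
        (by rw [displacement_append, displacement_append]; linear_combination d₁ - d₂ - e₄)
      rw [liftDisplacement_append, liftDisplacement_append] at e
      have e' := congrArg (charLift c) e
      rw [map_add, map_add, c₄] at e'
      have : charLift c (liftDisplacement l₀) = wordEigenvalue c u *
          charLift c (liftDisplacement l₃) + charLift c (liftDisplacement l₂) -
            charLift c (liftDisplacement l₁) := by linear_combination e'
      rw [this]
      have b₃ : ‖wordEigenvalue c u * charLift c (liftDisplacement l₃)‖ ≤ r * D := by
        rw [norm_mul]
        exact mul_le_mul_of_nonneg_left (ih t _ _ p₃) (norm_nonneg _)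
      have := norm_sub_le (wordEigenvalue c u *
          charLift c (liftDisplacement l₃) + charLift c (liftDisplacement l₂))
            (charLift c (liftDisplacement l₁))
      have := norm_add_le (wordEigenvalue c u *
          charLift c (liftDisplacement l₃)) (charLift c (liftDisplacement l₂))
      linarith

/-! ## Legal tilings -/

/-- A path runs along finitely many tiles, to which legality applies. Translation leaves the list of
directions, hence the lift, unchanged. -/
theorem IsLegal.exists_path_metatile {T : Set (Tile n)} (hT : σ.IsLegal T) {q : ℂ}
    {l : List (ZMod (2 * n))} (h : IsEdgePath T q l) :
    ∃ m t p, IsEdgePath (σ.metatile m t) p l := by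
  obtain ⟨F, hFT, hF, hl⟩ := h.exists_finite
  obtain ⟨m, t, c, hc⟩ := hT F hFT hF
  exact ⟨m, t, c + q, (hl.translate c).mono hc⟩

theorem IsDefinedBy.hasClosedLifts [NeZero n] (hσ : σ.IsDefinedBy u) {T : Set (Tile n)}
    (hT : σ.IsLegal T) : HasClosedLifts T := by
  intro q l h h0
  obtain ⟨m, t, p, h'⟩ := hT.exists_path_metatile h
  exact (hσ.patch m t).simplyConnected.hasClosedLifts p l h' h0

end Substitution

/-! ## Distance to the slope -/

/-- The point of the slope with the same first coordinate for the characters as `x`. -/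
def slopePoint (x : Fin n → ℤ) : EuclideanSpace ℝ (Fin n) :=
  WithLp.toLp 2 fun j => 2 / n * ((charLift (1 : ZMod (2 * n)) x).re *
    Real.cos ((j : ℕ) * Real.pi / n) + (charLift (1 : ZMod (2 * n)) x).im *
      Real.sin ((j : ℕ) * Real.pi / n))

theorem slopePoint_mem_slope (x : Fin n → ℤ) : slopePoint x ∈ slope n 0 := by
  rw [slope, Submodule.mem_span_pair]
  refine ⟨2 / n * (charLift (1 : ZMod (2 * n)) x).re,
    2 / n * (charLift (1 : ZMod (2 * n)) x).im, ?_⟩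
  ext j
  simp [slopePoint]
  ring

theorem vec_natCast_im [NeZero n] (k : ℕ) :
    (vec n (k : ZMod (2 * n))).im = Real.sin (k * Real.pi / n) := by
  rw [vec_natCast, Complex.exp_ofReal_mul_I_im]

theorem charLift_neg [NeZero n] (c : ZMod (2 * n)) (x : Fin n → ℤ) :
    charLift (-c) x = (starRingEnd ℂ) (charLift c x) := by
  simp_rw [charLift_apply, map_sum, map_mul, neg_mul, vec_neg]
  simp

/-- In the inversion formula the terms `k = 0` and `k = n - 1` have indices `1` and `-1`. They are
complex conjugate, and their sum is `n` times the coordinate of `slopePoint x`; the remaining terms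
are the contracted characters. -/
theorem sub_slopePoint_apply [NeZero n] (hn : 2 ≤ n) (x : Fin n → ℤ) (j : Fin n) :
    (((x j : ℝ) - slopePoint x j : ℝ) : ℂ) = (1 / n) * ∑ k ∈ Finset.Ico 1 (n - 1),
      charLift ((2 * k + 1 : ℕ) : ZMod (2 * n)) x *
        vec n (-(((2 * k + 1 : ℕ) : ZMod (2 * n)) * dir j)) := by
  have hn0 : (n : ℂ) ≠ 0 := by exact_mod_cast NeZero.ne n
  have h := charLift_inversion x j
  obtain ⟨m, rfl⟩ : ∃ m, n = m + 1 := ⟨n - 1, by omega⟩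
  rw [Finset.sum_range_succ, Finset.range_eq_Ico,
    Finset.sum_eq_sum_Ico_succ_bot (by omega)] at h
  have hlast : ((2 * m + 1 : ℕ) : ZMod (2 * (m + 1))) = -1 := by
    have := half_add_half (n := m + 1)
    push_cast at this ⊢
    linear_combination this
  rw [hlast, charLift_neg, mul_zero, zero_add, Nat.cast_one, neg_mul, one_mul, neg_neg,
    vec_neg] at h
  have hre : (charLift (1 : ZMod (2 * (m + 1))) x * (starRingEnd ℂ) (vec (m + 1) (dir j)) +
      (starRingEnd ℂ) (charLift (1 : ZMod (2 * (m + 1))) x) * vec (m + 1) (dir j)) =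
      (((m + 1 : ℕ) : ℝ) * slopePoint x j : ℝ) := by
    have : (starRingEnd ℂ) (charLift (1 : ZMod (2 * (m + 1))) x) * vec (m + 1) (dir j) =
        (starRingEnd ℂ) (charLift (1 : ZMod (2 * (m + 1))) x *
          (starRingEnd ℂ) (vec (m + 1) (dir j))) := by
      rw [map_mul, Complex.conj_conj]
    rw [this, Complex.add_conj, Complex.mul_re, Complex.conj_re, Complex.conj_im, dir,
      vec_natCast_re, vec_natCast_im]
    congr 1
    have : ((m + 1 : ℕ) : ℝ) ≠ 0 := by positivity
    simp only [slopePoint]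
    field_simp
    ring
  rw [Nat.add_sub_cancel]
  push_cast at h hre hn0 ⊢
  field_simp
  linear_combination hre - h

theorem abs_sub_slopePoint_apply_le [NeZero n] (hn : 2 ≤ n) (x : Fin n → ℤ) (j : Fin n)
    {D : ℕ → ℝ} (hD : ∀ k, 1 ≤ k → k + 2 ≤ n →
      ‖charLift ((2 * k + 1 : ℕ) : ZMod (2 * n)) x‖ ≤ D k) :
    |(x j : ℝ) - slopePoint x j| ≤ 1 / n * ∑ k ∈ Finset.Ico 1 (n - 1), D k := by
  rw [← Real.norm_eq_abs, ← Complex.norm_real, sub_slopePoint_apply hn, norm_mul]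
  have : ‖(1 / n : ℂ)‖ = 1 / n := by simp
  rw [this]
  refine mul_le_mul_of_nonneg_left ((norm_sum_le _ _).trans (Finset.sum_le_sum fun k hk => ?_))
    (by positivity)
  have := Finset.mem_Ico.1 hk
  rw [norm_mul, norm_vec, mul_one]
  exact hD k this.1 (by omega)

/-- The square root bounds the distance from the vertex `x`; each `+ 1` accounts for one side of the
unit square. -/
theorem infDist_slope_le [NeZero n] (hn : 2 ≤ n) (x : Fin n → ℤ) (i j : Fin n) {a b : ℝ}
    (ha : a ∈ Set.Icc (0 : ℝ) 1) (hb : b ∈ Set.Icc (0 : ℝ) 1) {D : ℕ → ℝ}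
    (hD : ∀ k, 1 ≤ k → k + 2 ≤ n →
      ‖charLift ((2 * k + 1 : ℕ) : ZMod (2 * n)) x‖ ≤ D k) :
    Metric.infDist (WithLp.toLp 2 (fun m => (x m : ℝ)) + a • EuclideanSpace.single i (1 : ℝ) +
        b • EuclideanSpace.single j (1 : ℝ)) (slope n 0 : Set (EuclideanSpace ℝ (Fin n))) ≤
      Real.sqrt (∑ _m : Fin n, (1 / n * ∑ k ∈ Finset.Ico 1 (n - 1), D k) ^ 2) + 1 + 1 := by
  refine (Metric.infDist_le_dist_of_mem (slopePoint_mem_slope x)).trans ?_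
  rw [dist_eq_norm, show ∀ p q r s : EuclideanSpace ℝ (Fin n), p + q + r - s = p - s + q + r from
    fun p q r s => by abel]
  have h1 : ‖WithLp.toLp 2 (fun m => (x m : ℝ)) - slopePoint x‖ ≤
      Real.sqrt (∑ _m : Fin n, (1 / n * ∑ k ∈ Finset.Ico 1 (n - 1), D k) ^ 2) := by
    rw [EuclideanSpace.norm_eq]
    refine Real.sqrt_le_sqrt (Finset.sum_le_sum fun m _ => ?_)
    exact pow_le_pow_left₀ (norm_nonneg _) (abs_sub_slopePoint_apply_le hn x m hD) 2
  have hs : ∀ (s : ℝ) (i : Fin n), s ∈ Set.Icc (0 : ℝ) 1 →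
      ‖s • EuclideanSpace.single i (1 : ℝ)‖ ≤ 1 := by
    intro s i hs
    rw [norm_smul, PiLp.norm_single, norm_one, mul_one, Real.norm_of_nonneg hs.1]
    exact hs.2
  exact (norm_add₃_le).trans (add_le_add (add_le_add h1 (hs a i ha)) (hs b j hb))

theorem Substitution.IsDefinedBy.isPlanar [NeZero n] (hn : 2 ≤ n) {σ : Substitution n}
    {u : List ℕ} (hσ : σ.IsDefinedBy u) (hu : u ≠ [])
    (hlt : ∀ k, 1 ≤ k → k + 2 ≤ n →
      ‖wordEigenvalue ((2 * k + 1 : ℕ) : ZMod (2 * n)) u‖ < 1) :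
    σ.IsPlanar (slope n 0) := by
  intro T _ hT o _
  obtain ⟨L, hL, hpath⟩ := (hσ.hasClosedLifts hT).exists_lift
  choose! D hD using fun k (h1 : 1 ≤ k) (h2 : k + 2 ≤ n) =>
    hσ.exists_norm_charLift_le hu k (hlt k h1 h2)
  have hLD : ∀ k, 1 ≤ k → k + 2 ≤ n → ∀ p,
      ‖charLift ((2 * k + 1 : ℕ) : ZMod (2 * n)) (L p)‖ ≤ D k := by
    intro k h1 h2 p
    obtain ⟨q, l, hl, e⟩ := hpath p
    obtain ⟨m, t, q', hl'⟩ := hT.exists_path_metatile hl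
    rw [e]
    exact hD k h1 h2 m t q' l hl'
  -- Recentring at `o` doubles the bound, whence `D k + D k`.
  refine ⟨fun p => L p - L o, ⟨sub_self _, fun q a h => ?_⟩,
    Real.sqrt (∑ _m : Fin n, (1 / n * ∑ k ∈ Finset.Ico 1 (n - 1), (D k + D k)) ^ 2) + 1 + 1, ?_⟩
  · change L (q + vec n a) - L o = L q - L o + step a
    rw [hL q a h]
    abel
  · rintro _ ⟨τ, _, a, ha, b, hb, rfl⟩
    refine infDist_slope_le hn _ _ _ ha hb fun k h1 h2 => ?_
    rw [map_sub]
    exact (norm_sub_le _ _).trans (add_le_add (hLD k h1 h2 _) (hLD k h1 h2 _))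

end

end PlanarRosa

theorem mainTheorem11 (n : ℕ) (hn : Even n) (hn4 : 4 ≤ n) :
    ∃ ε : ℝ, 0 < ε ∧ ∃ l : ℕ,
      ∀ (u : List ℕ) (σ : PlanarRosa.Substitution n),
        (∀ a ∈ u, a ∈ PlanarRosa.alphabet n) →
        σ.IsDefinedBy u →
        l ≤ u.length →
        Metric.infDist (PlanarRosa.abelianized n u)
          (Submodule.span ℝ {PlanarRosa.gammaVec n} :
            Set (EuclideanSpace ℝ (Fin (n / 2)))) < ε →
        1 < ‖σ.factor‖ ∧ σ.IsPlanar (PlanarRosa.slope n 0) := by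
  have hn0 : (4 : ℝ) ≤ n := by exact_mod_cast hn4
  have : NeZero n := ⟨by omega⟩
  -- With `ε = 1/n` the contracted eigenvalues stay below `(n/2) · (1/n) · 2 = 1`; with `l = n`
  -- letters, each contributing at least `2/n`, the factor has real part at least 2.
  refine ⟨1 / n, by positivity, n, fun u σ hu hσ hlen hd => ⟨?_, ?_⟩⟩
  · have h1 := PlanarRosa.two_mul_length_div_le_wordEigenvalue_re hn4 u hu
    rw [← hσ.factor_eq (by omega)] at h1
    have h2 : (n : ℝ) ≤ u.length := by exact_mod_cast hlen
    have h3 : 2 / (n : ℝ) * n ≤ 2 / n * u.length := mul_le_mul_of_nonneg_left h2 (by positivity)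
    rw [div_mul_cancel₀ _ (by linarith)] at h3
    have := Complex.re_le_norm σ.factor
    linarith
  · exact hσ.isPlanar (by omega) (List.ne_nil_of_length_pos (by omega))
      fun k h1 h2 => PlanarRosa.norm_wordEigenvalue_lt_one hn u hu hd k h1 h2
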